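/- Let $m\in\mathbb R$. Minkowski space $\mathbb R^{1,3}=\{x=(t,\vec x): t\in\mathbb R,\ \vec x\in\mathbb R^3\}$ carries the form $x_\mu x^\mu=-t^2+|\vec x|^2$, and $\Box=\partial_\mu\partial^\mu=-\partial_t^2+\Delta_{\vec x}$. Let $J=\{x: x_\mu x^\mu\le 0\}$ be the solid double light cone (including $0$), and $J(\mathcal O)=\mathcal O+J$ for $\mathcal O\subset\mathbb R^{1,3}$. A function $f$ on $\mathbb R^{1,3}$ is space-compact if $\operatorname{supp}f\subset J(K)$ for some compact $K\subset\mathbb R^{1,3}$; $C^\infty_{\rm sc}(\mathbb R^{1,3})$ is the set of smooth complex-valued space-compact functions. For $t\in\mathbb R$ the Pauli–Jordan function $D(t,\cdot)$ is the tempered distribution on $\mathbb R^3$ $$D(t,\vec x)=\int_{\mathbb R^3}\frac{{\rm d}\vec k}{(2\pi)^3\sqrt{\vec k^2+m^2}}\,{\rm e}^{{\rm i}\vec k\cdot\vec x}\sin\!\big(t\sqrt{\vec k^2+m^2}\big),$$ the integral being an inverse Fourier transform of distributions, and $\dot D(t,\cdot)$ is its time derivative, $\langle\dot D(t,\cdot),\varphi\rangle=\partial_t\langle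 D(t,\cdot),\varphi\rangle$ for Schwartz functions $\varphi$ (the map $t\mapsto\langle D(t,\cdot),\varphi\rangle$ is differentiable for every such $\varphi$). **Theorem.** Let $\varsigma,\vartheta\in C_{\rm c}^\infty(\mathbb R^3)$ (complex-valued). There exists a unique $\zeta\in C^\infty_{\rm sc}(\mathbb R^{1,3})$ that solves $$(-\Box+m^2)\zeta=0,\qquad \zeta(0,\vec x)=\varsigma(\vec x),\quad \dot\zeta(0,\vec x)=\vartheta(\vec x).$$ It satisfies $\operatorname{supp}\zeta\subset J(\operatorname{supp}\varsigma\cup\operatorname{supp}\vartheta)$, where $\mathbb R^3$ is identified with the hyperplane $\{t=0\}$, and for all $(t,\vec x)$ $$\zeta(t,\vec x)=\int_{\mathbb R^3}\dot D(t,\vec x-\vec y)\,\varsigma(\vec y)\,{\rm d}\vec y+\int_{\mathbb R^3}D(t,\vec x-\vec y)\,\vartheta(\vec y)\,{\rm d}\vec y,$$ the integrals denoting the pairings $\langle\dot D(t,\cdot),\varsigma(\vec x-\cdot)\rangle$ and $\langle D(t,\cdot),\vartheta(\vec x-\cdot)\rangle$. If $\varsigma$ and $\vartheta$ are real-valued,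 then so is $\zeta$. -/

import Mathlib

open MeasureTheory
open scoped SchwartzMap ContDiff FourierTransform Laplacian Pointwise ENNReal

noncomputable section

namespace KleinGordon

/-- The spatial part `ℝ³` of Minkowski space. -/
abbrev Space : Type := EuclideanSpace ℝ (Fin 3)

/-- Minkowski space `ℝ^{1,3}`; a point is `x = (x⁰, x⃗) = (t, x⃗)`. -/
abbrev Minkowski : Type := ℝ × Space

/-- The form `x_μ x^μ = -(x⁰)² + |x⃗|²` of signature `(-+++)`. -/
def minkowskiSq (x : Minkowski) : ℝ := -(x.1 ^ 2) + ‖x.2‖ ^ 2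

/-- The closed future light cone. -/
def futureCone : Set Minkowski := {x | minkowskiSq x ≤ 0 ∧ 0 ≤ x.1}

/-- The closed past light cone. -/
def pastCone : Set Minkowski := {x | minkowskiSq x ≤ 0 ∧ x.1 ≤ 0}

/-- The causal shadow `J(𝒪) = 𝒪 + J` (pointwise sum of sets), where `J = J⁺ ∪ J⁻`. -/
def causalShadow (O : Set Minkowski) : Set Minkowski := O + (futureCone ∪ pastCone)

/-- The embedding of `ℝ³` into Minkowski space as the hyperplane `x⁰ = 0`. -/
def timeZero (x : Space) : Minkowski := (0, x)

/-- A function is space-compact if its support lies in the causal shadow of a compact set. -/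
def SpaceCompact (f : Minkowski → ℂ) : Prop :=
  ∃ K : Set Minkowski, IsCompact K ∧ tsupport f ⊆ causalShadow K

/-- The time derivative `∂_t f(t, x⃗)`. -/
def timeDeriv (f : Minkowski → ℂ) (x : Minkowski) : ℂ :=
  deriv (fun s : ℝ => f (s, x.2)) x.1

/-- The d'Alembertian `□ = ∂_μ ∂^μ = -∂_t² + Δ`. -/
def box (f : Minkowski → ℂ) (x : Minkowski) : ℂ :=
  -timeDeriv (timeDeriv f) x + (Δ (fun y : Space => f (x.1, y))) x.2

/-- `ζ` is a smooth space-compact solution of `(-□ + m²)ζ = 0` with Cauchy data `ς`, `ϑ` at time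
zero. -/
structure IsCauchySolution (m : ℝ) (ς ϑ : Space → ℂ) (ζ : Minkowski → ℂ) : Prop where
  smooth : ContDiff ℝ ∞ ζ
  spaceCompact : SpaceCompact ζ
  equation : ∀ x, -box ζ x + (m : ℂ) ^ 2 * ζ x = 0
  value_zero : ∀ x : Space, ζ (0, x) = ς x
  timeDeriv_zero : ∀ x : Space, timeDeriv ζ (0, x) = ϑ x

/-- The energy `√(|k⃗|² + m²)` at momentum `k⃗`. -/
def energy (m : ℝ) (k : Space) : ℝ := √(‖k‖ ^ 2 + m ^ 2)

/-- The bounded function `k⃗ ↦ sin(t √(|k⃗|² + m²)) / √(|k⃗|² + m²)`, evaluated at `2π k⃗`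
because Mathlib's Fourier transform uses the character `exp(2π i k⃗·x⃗)`.  (For `m = 0` the value
at the single point `k⃗ = 0` is irrelevant.) -/
def pauliJordanSymbol (m t : ℝ) (k : Space) : ℂ :=
  ((Real.sin (t * energy m ((2 * Real.pi) • k)) / energy m ((2 * Real.pi) • k) : ℝ) : ℂ)

lemma memLp_pauliJordanSymbol (m t : ℝ) :
    MemLp (pauliJordanSymbol m t) ∞ (volume : Measure Space) := by
  refine memLp_top_of_bound (C := |t|) ?_ (Filter.Eventually.of_forall fun k => ?_)
  · refine Measurable.aestronglyMeasurable ?_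
    unfold pauliJordanSymbol energy
    fun_prop
  · unfold pauliJordanSymbol
    rw [Complex.norm_real, Real.norm_eq_abs, abs_div]
    refine div_le_of_le_mul₀ (abs_nonneg _) (abs_nonneg _) ?_
    rw [← abs_mul]
    exact Real.abs_sin_le_abs

/-- The Pauli–Jordan function at time `t`, a tempered distribution in `x⃗`:
`D(t, x⃗) = ∫ dk⃗ / ((2π)³ √(|k⃗|² + m²)) e^{i k⃗·x⃗} sin(t √(|k⃗|² + m²))`,
the integral being an inverse Fourier transform in the sense of distributions. -/
def pauliJordan (m t : ℝ) : 𝓢'(Space, ℂ) :=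
  𝓕⁻ (Lp.toTemperedDistribution (memLp_pauliJordanSymbol m t).toLp)

/-- The time derivative `Ḋ(t, ·)` of `D(t, ·)` as a distribution:
`⟨Ḋ(t, ·), φ⟩ = ∂_t ⟨D(t, ·), φ⟩`. -/
def pauliJordanDot (m t : ℝ) (φ : 𝓢(Space, ℂ)) : ℂ :=
  deriv (fun s : ℝ => pauliJordan m s φ) t

/-- The test function `y⃗ ↦ f(x⃗ - y⃗)`. -/
def reflectTranslate (f : Space → ℂ) (hf : ContDiff ℝ ∞ f) (hc : HasCompactSupport f)
    (x : Space) : 𝓢(Space, ℂ) :=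
  HasCompactSupport.toSchwartzMap (f := fun y => f (x - y))
    (hc.comp_homeomorph (Homeomorph.subLeft x)) (hf.comp (contDiff_const.sub contDiff_id))

/-- The convolution `∫ T(x⃗ - y⃗) f(y⃗) dy⃗ = ⟨T, f(x⃗ - ·)⟩` of a distribution with a test
function. -/
def distConv (T : 𝓢(Space, ℂ) → ℂ) (f : Space → ℂ) (hf : ContDiff ℝ ∞ f)
    (hc : HasCompactSupport f) (x : Space) : ℂ :=
  T (reflectTranslate f hf hc x)

end KleinGordon

end

noncomputable section

namespace KleinGordon

/-! Existence comes from plane waves. With E the energy at momentum 2πk, the candidate is the sum of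
the Fourier integrals of two measures on space-time frequency space, carried by the upper and lower
mass shells. Time is thus one more Fourier variable: joint smoothness needs only finite moments of
the amplitudes (`contDiff_superposition`), and the equation holds because its symbol vanishes on the
shells (`kleinGordon_superposition`). Euler's formulas merge the two shells into the multipliers
cos(tE) and sin(tE)/E, which are those of Ḋ and D (`planeWaveSolution_eq_distConv`). For m = 0 the
amplitudes may blow up like 1/|k| at the origin, which is integrable in three dimensions.

Everything else follows from a local energy estimate. The energy is weighted by a smooth cut-off
living in a backward cone, whose level sets are spacelike hyperboloids; the flux through them has a
sign, so the weighted energy does not increase (`fderiv_energyDensity_le`). Hence data vanishing on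
a ball force the solution to vanish at points of the cone's axis
(`eq_zero_of_cauchyData_eq_zero_on_ball`). Applied to real and imaginary parts, to differences of
solutions and to the imaginary part alone, this gives the support property, uniqueness and reality.
-/

/-! ### Elementary bounds on the energy -/

lemma energy_sq (m : ℝ) (k : Space) : energy m k ^ 2 = ‖k‖ ^ 2 + m ^ 2 :=
  Real.sq_sqrt (by positivity)

lemma energy_nonneg (m : ℝ) (k : Space) : 0 ≤ energy m k := Real.sqrt_nonneg _

lemma norm_le_energy (m : ℝ) (k : Space) : ‖k‖ ≤ energy m k :=
  Real.le_sqrt_of_sq_le (by nlinarith [sq_nonneg m])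

lemma energy_le (m : ℝ) (k : Space) : energy m k ≤ ‖k‖ + |m| :=
  Real.sqrt_le_iff.2 ⟨by positivity, by
    nlinarith [sq_abs m, mul_nonneg (norm_nonneg k) (abs_nonneg m)]⟩

lemma continuous_energy (m : ℝ) : Continuous (energy m) := by
  unfold energy; fun_prop

lemma energy_ne_zero (m : ℝ) {k : Space} (hk : k ≠ 0) : energy m k ≠ 0 :=
  ((norm_pos_iff.2 hk).trans_le (norm_le_energy m k)).ne'

/-! ### The wave operator in terms of Fréchet derivatives -/

section Derivatives

variable {f : Minkowski → ℂ}

lemma timeDeriv_eq_fderiv (hf : Differentiable ℝ f) (x : Minkowski) :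
    timeDeriv f x = fderiv ℝ f x (1, 0) := by
  have h : HasDerivAt (fun s : ℝ => ((s, x.2) : Minkowski)) (1, 0) x.1 :=
    (hasDerivAt_id x.1).prodMk (hasDerivAt_const x.1 x.2)
  exact ((hf x).hasFDerivAt.comp_hasDerivAt (f := fun s : ℝ => ((s, x.2) : Minkowski)) x.1 h).deriv

lemma timeDeriv_timeDeriv_eq_fderiv (hf : ContDiff ℝ 2 f) (x : Minkowski) :
    timeDeriv (timeDeriv f) x = fderiv ℝ (fderiv ℝ f) x (1, 0) (1, 0) := by
  have h1 : ContDiff ℝ 1 (fderiv ℝ f) := hf.fderiv_right (by norm_num)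
  have h2 : timeDeriv f = fun y => fderiv ℝ f y (1, 0) :=
    funext (timeDeriv_eq_fderiv (hf.differentiable (by norm_num)))
  rw [h2, timeDeriv_eq_fderiv ((h1.differentiable (by norm_num)).clm_apply (by fun_prop)),
    fderiv_clm_apply (h1.differentiable (by norm_num) x) (by fun_prop)]
  simp

lemma laplacian_slice_eq_fderiv (hf : ContDiff ℝ 2 f) (x : Minkowski) :
    (Δ (fun y : Space => f (x.1, y))) x.2 =
      ∑ i, fderiv ℝ (fderiv ℝ f) x (0, EuclideanSpace.basisFun (Fin 3) ℝ i)
        (0, EuclideanSpace.basisFun (Fin 3) ℝ i) := by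
  have h1 : ContDiff ℝ 1 (fderiv ℝ f) := hf.fderiv_right (by norm_num)
  have hi (y : Space) : HasFDerivAt (fun y : Space => ((x.1, y) : Minkowski))
      (ContinuousLinearMap.inr ℝ ℝ Space) y := hasFDerivAt_prodMk_right x.1 y
  have h2 : fderiv ℝ (fun y : Space => f (x.1, y)) =
      fun y => (fderiv ℝ f (x.1, y)).comp (ContinuousLinearMap.inr ℝ ℝ Space) := by
    ext1 y
    exact (((hf.differentiable (by norm_num)) (x.1, y)).hasFDerivAt.comp y (hi y)).fderiv
  rw [InnerProductSpace.laplacian_eq_iteratedFDeriv_orthonormalBasis _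
    (EuclideanSpace.basisFun (Fin 3) ℝ)]
  refine Finset.sum_congr rfl fun i _ => ?_
  have h3 : HasFDerivAt (fun y : Space => fderiv ℝ f (x.1, y))
      ((fderiv ℝ (fderiv ℝ f) x).comp (ContinuousLinearMap.inr ℝ ℝ Space)) x.2 :=
    ((h1.differentiable (by norm_num)) (x.1, x.2)).hasFDerivAt.comp x.2 (hi x.2)
  rw [iteratedFDeriv_two_apply, h2,
    (h3.clm_comp (hasFDerivAt_const (ContinuousLinearMap.inr ℝ ℝ Space) x.2)).fderiv]
  simp

lemma box_eq_fderiv (hf : ContDiff ℝ 2 f) (x : Minkowski) :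
    box f x = -fderiv ℝ (fderiv ℝ f) x (1, 0) (1, 0) +
      ∑ i, fderiv ℝ (fderiv ℝ f) x (0, EuclideanSpace.basisFun (Fin 3) ℝ i)
        (0, EuclideanSpace.basisFun (Fin 3) ℝ i) := by
  rw [box, timeDeriv_timeDeriv_eq_fderiv hf, laplacian_slice_eq_fderiv hf]

end Derivatives

/-! ### Superpositions of plane waves on the mass shell -/

/-- The Euclidean pairing of frequencies and space-time points, with the opposite sign. -/
def phase : (ℝ × Space) →L[ℝ] Minkowski →L[ℝ] ℝ :=
  -((ContinuousLinearMap.mul ℝ ℝ).bilinearComp (ContinuousLinearMap.fst ℝ ℝ Space)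
      (ContinuousLinearMap.fst ℝ ℝ Space) +
    (show Space →L[ℝ] Space →L[ℝ] ℝ from innerSL ℝ).bilinearComp
      (ContinuousLinearMap.snd ℝ ℝ Space) (ContinuousLinearMap.snd ℝ ℝ Space))

lemma phase_apply (v : ℝ × Space) (w : Minkowski) :
    phase v w = -(v.1 * w.1 + inner ℝ v.2 w.2) := by
  simp only [phase, neg_apply, add_apply, ContinuousLinearMap.bilinearComp_apply]
  rfl

/-- The superposition of the plane waves `exp(2πi(v⁰ t + v⃗·x⃗))` with amplitude `f` and
frequency distribution `μ`. -/
def superposition (μ : Measure (ℝ × Space)) (f : ℝ × Space → ℂ) : Minkowski → ℂ :=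
  VectorFourier.fourierIntegral Real.fourierChar μ phase.toLinearMap₁₂ f

section Superposition

variable {μ : Measure (ℝ × Space)} {f : ℝ × Space → ℂ}

lemma superposition_apply (w : Minkowski) :
    superposition μ f w =
      ∫ v, Complex.exp (2 * Real.pi * (v.1 * w.1 + inner ℝ v.2 w.2 : ℝ) * Complex.I) * f v ∂μ := by
  unfold superposition VectorFourier.fourierIntegral
  refine integral_congr_ae (Filter.Eventually.of_forall fun v => ?_)
  change Real.fourierChar (-(phase v w)) • f v = _
  rw [phase_apply, neg_neg, Circle.smul_def, Real.fourierChar_apply, smul_eq_mul]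
  push_cast
  rfl

lemma contDiff_superposition (hf : ∀ n : ℕ, Integrable (fun v => ‖v‖ ^ n * ‖f v‖) μ) :
    ContDiff ℝ ∞ (superposition μ f) :=
  VectorFourier.contDiff_fourierIntegral phase fun n _ => hf n

lemma fderiv_fderiv_superposition (hf : ∀ n : ℕ, Integrable (fun v => ‖v‖ ^ n * ‖f v‖) μ)
    (hm : AEStronglyMeasurable f μ) (w a b : Minkowski) :
    fderiv ℝ (fderiv ℝ (superposition μ f)) w a b =
      superposition μ (fun v => -(4 * Real.pi ^ 2 * (phase v a * phase v b) : ℝ) * f v) w := by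
  have h := VectorFourier.iteratedFDeriv_fourierIntegral phase (N := ⊤) (fun n _ => hf n) hm
    (n := 2) le_top
  have h2 := iteratedFDeriv_two_apply (𝕜 := ℝ) (superposition μ f) w ![a, b]
  simp only [Matrix.cons_val_zero, Matrix.cons_val_one] at h2
  rw [← h2]
  unfold superposition
  have hint : Integrable (fun v => VectorFourier.fourierPowSMulRight phase f v 2) μ :=
    VectorFourier.integrable_fourierPowSMulRight phase (hf 2) hm
  rw [h]
  unfold VectorFourier.fourierIntegral
  rw [ContinuousMultilinearMap.integral_apply]
  · refine integral_congr_ae (Filter.Eventually.of_forall fun v => ?_)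
    simp only [smul_apply, Circle.smul_def,
      VectorFourier.fourierPowSMulRight_apply, Fin.prod_univ_two, Matrix.cons_val_zero,
      Matrix.cons_val_one, smul_eq_mul, Complex.real_smul]
    congr 1
    push_cast
    linear_combination (4 * (Real.pi : ℂ) ^ 2 * (phase v a * phase v b) * f v) * Complex.I_sq
  · exact (VectorFourier.fourierIntegral_convergent_iff Real.continuous_fourierChar
      (by exact phase.continuous₂) w).2 hint

lemma integrable_phase_mul (hf : ∀ n : ℕ, Integrable (fun v => ‖v‖ ^ n * ‖f v‖) μ)
    (hm : AEStronglyMeasurable f μ) (a b : Minkowski) :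
    Integrable (fun v => -(4 * Real.pi ^ 2 * (phase v a * phase v b) : ℝ) * f v) μ := by
  refine ((hf 2).const_mul (4 * Real.pi ^ 2 * (‖phase‖ * ‖a‖) * (‖phase‖ * ‖b‖))).mono' ?_
    (Filter.Eventually.of_forall fun v => ?_)
  · refine AEStronglyMeasurable.mul (Continuous.aestronglyMeasurable ?_) hm
    fun_prop
  · have h1 : ‖phase v a‖ ≤ ‖phase‖ * ‖v‖ * ‖a‖ := phase.le_opNorm₂ v a
    have h2 : ‖phase v b‖ ≤ ‖phase‖ * ‖v‖ * ‖b‖ := phase.le_opNorm₂ v b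
    rw [norm_mul, norm_neg, Complex.norm_real, norm_mul, norm_mul (phase v a),
      Real.norm_of_nonneg (by positivity : 0 ≤ 4 * Real.pi ^ 2)]
    calc 4 * Real.pi ^ 2 * (‖phase v a‖ * ‖phase v b‖) * ‖f v‖
        ≤ 4 * Real.pi ^ 2 * ((‖phase‖ * ‖v‖ * ‖a‖) * (‖phase‖ * ‖v‖ * ‖b‖)) * ‖f v‖ := by gcongr
      _ = _ := by ring

/-- On the plane wave of frequency v the operator multiplies by -(2πv⁰)² + (2π)²|v⃗|² + m², which is
zero almost everywhere for μ. -/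
lemma kleinGordon_superposition {m : ℝ}
    (hf : ∀ n : ℕ, Integrable (fun v => ‖v‖ ^ n * ‖f v‖) μ) (hm : AEStronglyMeasurable f μ)
    (hμ : ∀ᵐ v ∂μ, (2 * Real.pi * v.1) ^ 2 = (2 * Real.pi) ^ 2 * ‖v.2‖ ^ 2 + m ^ 2)
    (x : Minkowski) :
    -box (superposition μ f) x + (m : ℂ) ^ 2 * superposition μ f x = 0 := by
  rw [box_eq_fderiv (contDiff_infty.1 (contDiff_superposition hf) 2)]
  simp only [fderiv_fderiv_superposition hf hm, superposition_apply]
  have hi (g : ℝ × Space → ℂ) (hg : Integrable g μ) : Integrable (fun v => Complex.exp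
      (2 * Real.pi * (v.1 * x.1 + inner ℝ v.2 x.2 : ℝ) * Complex.I) * g v) μ := by
    refine hg.bdd_mul (c := 1) (Continuous.aestronglyMeasurable (by fun_prop))
      (Filter.Eventually.of_forall fun v => ?_)
    have : (2 * Real.pi * (v.1 * x.1 + inner ℝ v.2 x.2 : ℝ) * Complex.I : ℂ) =
      ((2 * Real.pi * (v.1 * x.1 + inner ℝ v.2 x.2) : ℝ) : ℂ) * Complex.I := by push_cast; ring
    rw [this, Complex.norm_exp_ofReal_mul_I]
  have hf0 : Integrable f μ := (integrable_norm_iff hm).1 (by simpa using hf 0)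
  have hd (a : Minkowski) := hi _ (integrable_phase_mul hf hm a a)
  have hs := integrable_finsetSum Finset.univ
    fun i _ => hd (0, EuclideanSpace.basisFun (Fin 3) ℝ i)
  rw [← integral_finsetSum _ fun i _ => hd _, neg_add_eq_sub, neg_add_eq_sub,
    ← integral_sub hs (hd _), ← integral_const_mul,
    ← integral_sub ((hi f hf0).const_mul _) (by exact hs.sub (hd (1, 0)))]
  refine integral_eq_zero_of_ae ?_
  filter_upwards [hμ] with v hv
  have hn : ‖v.2‖ ^ 2 = ∑ i, v.2 i ^ 2 := EuclideanSpace.real_norm_sq_eq v.2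
  rw [hn, Fin.sum_univ_three] at hv
  have hv' : ((2 * Real.pi * v.1) ^ 2 : ℂ) =
    (2 * Real.pi) ^ 2 * (v.2 0 ^ 2 + v.2 1 ^ 2 + v.2 2 ^ 2) + m ^ 2 := by exact_mod_cast hv
  simp only [phase_apply, Fin.sum_univ_three, EuclideanSpace.basisFun_apply,
    EuclideanSpace.inner_single_right, inner_zero_right, Pi.zero_apply]
  generalize Complex.exp _ = E
  simp
  linear_combination (-E * f v) * hv'

end Superposition

/-! ### The Pauli–Jordan function as a Fourier integral -/

lemma pauliJordan_apply (m t : ℝ) (φ : 𝓢(Space, ℂ)) :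
    pauliJordan m t φ = ∫ k, pauliJordanSymbol m t k * (𝓕⁻ φ) k := by
  rw [pauliJordan, TemperedDistribution.fourierInv_apply, Lp.toTemperedDistribution_apply]
  refine integral_congr_ae ?_
  filter_upwards [(memLp_pauliJordanSymbol m t).coeFn_toLp] with k hk
  rw [hk, smul_eq_mul, mul_comm]

lemma measurable_pauliJordanSymbol (m t : ℝ) : Measurable (pauliJordanSymbol m t) := by
  unfold pauliJordanSymbol energy
  fun_prop

lemma norm_pauliJordanSymbol_le (m t : ℝ) (k : Space) : ‖pauliJordanSymbol m t k‖ ≤ |t| := by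
  rw [pauliJordanSymbol, Complex.norm_real, Real.norm_eq_abs, abs_div]
  refine div_le_of_le_mul₀ (abs_nonneg _) (abs_nonneg _) ?_
  rw [← abs_mul]
  exact Real.abs_sin_le_abs

/-- The s-derivative of sin(sE)/E is cos(sE), bounded by one, so the integrable function |𝓕⁻φ|
dominates uniformly in s. -/
lemma hasDerivAt_pauliJordan (m t : ℝ) (φ : 𝓢(Space, ℂ)) :
    HasDerivAt (fun s => pauliJordan m s φ)
      (∫ k, (Real.cos (t * energy m ((2 * Real.pi) • k)) : ℂ) * (𝓕⁻ φ) k) t := by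
  simp_rw [pauliJordan_apply]
  have hφ : Integrable (𝓕⁻ φ : 𝓢(Space, ℂ)) := (𝓕⁻ φ).integrable
  have hmeas (s : ℝ) : AEStronglyMeasurable
      (fun k => pauliJordanSymbol m s k * (𝓕⁻ φ) k) volume :=
    (measurable_pauliJordanSymbol m s).aestronglyMeasurable.mul hφ.aestronglyMeasurable
  refine (hasDerivAt_integral_of_dominated_loc_of_deriv_le (s := Set.univ)
    (bound := fun k => ‖(𝓕⁻ φ) k‖) (F := fun s k => pauliJordanSymbol m s k * (𝓕⁻ φ) k)
    (F' := fun s k => (Real.cos (s * energy m ((2 * Real.pi) • k)) : ℂ) * (𝓕⁻ φ) k)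
    Filter.univ_mem (Filter.Eventually.of_forall hmeas) ?_ ?_ ?_ hφ.norm ?_).2
  · exact hφ.bdd_mul (c := |t|) (measurable_pauliJordanSymbol m t).aestronglyMeasurable
      (Filter.Eventually.of_forall (norm_pauliJordanSymbol_le m t))
  · refine AEStronglyMeasurable.mul (Continuous.aestronglyMeasurable ?_) hφ.aestronglyMeasurable
    have := continuous_energy m
    fun_prop
  · refine Filter.Eventually.of_forall fun k s _ => ?_
    rw [norm_mul, Complex.norm_real]
    exact mul_le_of_le_one_left (norm_nonneg _) (Real.abs_cos_le_one _)
  -- For m = 0 and k = 0 the symbol is 0 by the convention for division by zero, and its derivative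
  -- is not the cosine; that point is null.
  · filter_upwards [Measure.ae_ne volume (0 : Space)] with k hk s _
    have hE : energy m ((2 * Real.pi) • k) ≠ 0 :=
      energy_ne_zero m (smul_ne_zero (by positivity) hk)
    have h1 : HasDerivAt (fun s : ℝ => s * energy m ((2 * Real.pi) • k))
        (energy m ((2 * Real.pi) • k)) s := by
      simpa using (hasDerivAt_id s).mul_const (energy m ((2 * Real.pi) • k))
    have h2 := (h1.sin.div_const (energy m ((2 * Real.pi) • k))).ofReal_comp
    rw [mul_div_cancel_right₀ _ hE] at h2
    exact h2.mul_const _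

lemma differentiable_pauliJordan (m : ℝ) (φ : 𝓢(Space, ℂ)) :
    Differentiable ℝ (fun s => pauliJordan m s φ) :=
  fun t => (hasDerivAt_pauliJordan m t φ).differentiableAt

lemma pauliJordanDot_apply (m t : ℝ) (φ : 𝓢(Space, ℂ)) :
    pauliJordanDot m t φ =
      ∫ k, (Real.cos (t * energy m ((2 * Real.pi) • k)) : ℂ) * (𝓕⁻ φ) k :=
  (hasDerivAt_pauliJordan m t φ).deriv

/-- The reflection turns the inverse transform into the direct one and the translation becomes a
phase, so pairings with D and Ḋ are plane-wave integrals of the transformed data. -/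
lemma fourierInv_reflectTranslate (f : Space → ℂ) (hf : ContDiff ℝ ∞ f)
    (hc : HasCompactSupport f) (x k : Space) :
    (𝓕⁻ (reflectTranslate f hf hc x)) k =
      Complex.exp (2 * Real.pi * inner ℝ k x * Complex.I) * 𝓕 f k := by
  have hcoe : ⇑(reflectTranslate f hf hc x) = fun y => f (x - y) := rfl
  rw [SchwartzMap.fourierInv_coe, hcoe, Real.fourierInv_eq', Real.fourier_eq',
    ← integral_const_mul, ← integral_sub_left_eq_self _ volume x]
  refine integral_congr_ae (Filter.Eventually.of_forall fun y => ?_)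
  simp only [sub_sub_cancel, smul_eq_mul]
  rw [← mul_assoc, ← Complex.exp_add, inner_sub_left, real_inner_comm k x]
  push_cast
  ring_nf

/-! ### Integrability of amplitudes on the mass shell -/

/-- The Jacobian r² absorbs the singularity 1/r at the origin, and the remaining r/(1 + r)³ is at
most 1/(1 + r²). -/
lemma integrable_inv_norm_mul_one_add_norm_pow :
    Integrable (fun k : Space => ((1 + ‖k‖) ^ 3 * ‖k‖)⁻¹) := by
  rw [integrable_fun_norm_addHaar volume (f := fun r : ℝ => ((1 + r) ^ 3 * r)⁻¹)]
  refine (integrable_inv_one_add_sq.integrableOn (s := Set.Ioi 0)).mono' ?_ ?_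
  · exact Measurable.aestronglyMeasurable (by fun_prop)
  · refine (ae_restrict_mem measurableSet_Ioi).mono fun r (hr : 0 < r) => ?_
    have h3 : Module.finrank ℝ Space - 1 = 2 := by simp
    rw [h3, smul_eq_mul, Real.norm_of_nonneg (by positivity), ← div_eq_mul_inv, ← one_div,
      div_le_div_iff₀ (by positivity) (by positivity)]
    nlinarith [pow_pos hr 2, pow_pos hr 3]

/-- The map from momenta to the (upper or lower, according to `σ = ±1`) mass shell. -/
def massShell (m σ : ℝ) (k : Space) : ℝ × Space :=
  (σ * energy m ((2 * Real.pi) • k) / (2 * Real.pi), k)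

lemma continuous_massShell (m σ : ℝ) : Continuous (massShell m σ) := by
  have := continuous_energy m
  unfold massShell
  fun_prop

lemma norm_massShell_le (m σ : ℝ) (hσ : |σ| = 1) (k : Space) :
    ‖massShell m σ k‖ ≤ (1 + |m|) * (1 + ‖k‖) := by
  have hπ : (1 : ℝ) ≤ 2 * Real.pi := by linarith [Real.pi_gt_three]
  have hm := abs_nonneg m
  have hk := norm_nonneg k
  have hmk := mul_nonneg hm hk
  refine max_le ?_ (by change ‖k‖ ≤ _; nlinarith)
  have h := energy_le m ((2 * Real.pi) • k)
  rw [norm_smul, Real.norm_of_nonneg (by positivity)] at h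
  change ‖σ * energy m ((2 * Real.pi) • k) / (2 * Real.pi)‖ ≤ _
  rw [norm_div, norm_mul, Real.norm_eq_abs σ, hσ, one_mul, Real.norm_of_nonneg (energy_nonneg _ _),
    Real.norm_of_nonneg (by positivity : 0 ≤ 2 * Real.pi), div_le_iff₀ (by positivity)]
  nlinarith

lemma massShell_eq (m σ : ℝ) (hσ : |σ| = 1) :
    ∀ᵐ v ∂(volume.map (massShell m σ)),
      (2 * Real.pi * v.1) ^ 2 = (2 * Real.pi) ^ 2 * ‖v.2‖ ^ 2 + m ^ 2 := by
  rw [ae_map_iff (continuous_massShell m σ).aemeasurable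
    (measurableSet_eq_fun (by fun_prop) (by fun_prop))]
  refine Filter.Eventually.of_forall fun k => ?_
  have h := energy_sq m ((2 * Real.pi) • k)
  rw [norm_smul, Real.norm_of_nonneg (by positivity : 0 ≤ 2 * Real.pi)] at h
  have h1 : 2 * Real.pi * (massShell m σ k).1 = σ * energy m ((2 * Real.pi) • k) := by
    unfold massShell
    field_simp
  rw [h1, mul_pow, ← sq_abs σ, hσ, h, massShell]
  ring

/-- The decay hypothesis bounds |k||h(k)| rather than |h(k)|, leaving room for a singularity 1/|k|
at the origin. -/
lemma integrable_norm_pow_mul_massShell (m σ : ℝ) (hσ : |σ| = 1) {h : Space → ℂ}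
    (hm : Measurable h)
    (hdecay : ∀ n : ℕ, ∃ C, ∀ k, (1 + ‖k‖) ^ n * (‖k‖ * ‖h k‖) ≤ C) (n : ℕ) :
    Integrable (fun v => ‖v‖ ^ n * ‖h v.2‖) (volume.map (massShell m σ)) := by
  rw [integrable_map_measure (Measurable.aestronglyMeasurable (by fun_prop))
    (continuous_massShell m σ).aemeasurable]
  -- The n powers pay for the moment on the shell, the other three for integrability at infinity.
  obtain ⟨C, hC⟩ := hdecay (n + 3)
  refine (integrable_inv_norm_mul_one_add_norm_pow.const_mul ((1 + |m|) ^ n * C)).mono' ?_ ?_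
  · have := (continuous_massShell m σ).measurable
    exact Measurable.aestronglyMeasurable (by unfold massShell at *; fun_prop)
  · filter_upwards [Measure.ae_ne volume (0 : Space)] with k hk
    have hk' := norm_pos_iff.2 hk
    rw [Function.comp_apply, Real.norm_of_nonneg (by positivity), ← div_eq_mul_inv,
      le_div_iff₀ (by positivity)]
    calc ‖massShell m σ k‖ ^ n * ‖h (massShell m σ k).2‖ * ((1 + ‖k‖) ^ 3 * ‖k‖)
        ≤ ((1 + |m|) * (1 + ‖k‖)) ^ n * ‖h k‖ * ((1 + ‖k‖) ^ 3 * ‖k‖) := by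
          gcongr
          · exact norm_massShell_le m σ hσ k
          · exact le_rfl
      _ = (1 + |m|) ^ n * ((1 + ‖k‖) ^ (n + 3) * (‖k‖ * ‖h k‖)) := by rw [mul_pow]; ring
      _ ≤ (1 + |m|) ^ n * C := by gcongr; exact hC k

/-- The amplitude on the mass shell `σ = ±1` of the solution with Cauchy data whose Fourier
transforms are `g` and `h`. -/
def amplitude (m σ : ℝ) (g h : Space → ℂ) (k : Space) : ℂ :=
  (g k + σ * h k / (Complex.I * energy m ((2 * Real.pi) • k))) / 2

lemma measurable_amplitude (m σ : ℝ) {g h : Space → ℂ} (hg : Measurable g) (hh : Measurable h) :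
    Measurable (amplitude m σ g h) := by
  have := (continuous_energy m).measurable
  unfold amplitude
  fun_prop

/-- Since E ≥ |k|, the factor |k| cancels the division by E for every m, zero included; the rest is
Schwartz decay of g and h. -/
lemma amplitude_decay (m σ : ℝ) (hσ : |σ| = 1) (g h : 𝓢(Space, ℂ)) (n : ℕ) :
    ∃ C, ∀ k, (1 + ‖k‖) ^ n * (‖k‖ * ‖amplitude m σ g h k‖) ≤ C := by
  have hS (f : 𝓢(Space, ℂ)) (N : ℕ) : ∃ C, ∀ k, (1 + ‖k‖) ^ N * ‖f k‖ ≤ C := by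
    have h := fun k => SchwartzMap.one_add_le_sup_seminorm_apply (𝕜 := ℝ) (m := (N, 0)) le_rfl
      le_rfl f k
    simp only [norm_iteratedFDeriv_zero] at h
    exact ⟨_, h⟩
  obtain ⟨C, hC⟩ := hS g (n + 1)
  obtain ⟨C', hC'⟩ := hS h n
  refine ⟨C + C', fun k => ?_⟩
  have hk := norm_nonneg k
  set E := energy m ((2 * Real.pi) • k) with hEdef
  have hE : ‖k‖ ≤ E := by
    have := norm_le_energy m ((2 * Real.pi) • k)
    rw [norm_smul, Real.norm_of_nonneg (by positivity)] at this
    nlinarith [Real.pi_gt_three]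
  have h1 : ‖k‖ * ‖amplitude m σ g h k‖ ≤ (1 + ‖k‖) * ‖g k‖ + ‖h k‖ := by
    have h2 : ‖amplitude m σ g h k‖ ≤ ‖g k‖ + ‖h k‖ / E := by
      rw [amplitude, norm_div, RCLike.norm_ofNat]
      refine (div_le_self (norm_nonneg _) (by norm_num)).trans ((norm_add_le _ _).trans ?_)
      rw [norm_div, norm_mul, norm_mul, Complex.norm_real, Real.norm_eq_abs, hσ, Complex.norm_I,
        Complex.norm_real, Real.norm_of_nonneg (energy_nonneg _ _), one_mul, one_mul]
    calc ‖k‖ * ‖amplitude m σ g h k‖ ≤ ‖k‖ * (‖g k‖ + ‖h k‖ / E) := by gcongr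
      _ = ‖k‖ * ‖g k‖ + ‖k‖ / E * ‖h k‖ := by ring
      _ ≤ (1 + ‖k‖) * ‖g k‖ + 1 * ‖h k‖ := by
        gcongr
        · linarith
        · exact div_le_one_of_le₀ hE (hk.trans hE)
      _ = _ := by ring
  calc (1 + ‖k‖) ^ n * (‖k‖ * ‖amplitude m σ g h k‖)
      ≤ (1 + ‖k‖) ^ n * ((1 + ‖k‖) * ‖g k‖ + ‖h k‖) := by gcongr
    _ = (1 + ‖k‖) ^ (n + 1) * ‖g k‖ + (1 + ‖k‖) ^ n * ‖h k‖ := by ring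
    _ ≤ C + C' := add_le_add (hC k) (hC' k)

/-! ### The solution given by the Pauli–Jordan function -/

lemma box_add {f g : Minkowski → ℂ} (hf : ContDiff ℝ 2 f) (hg : ContDiff ℝ 2 g) (x : Minkowski) :
    box (f + g) x = box f x + box g x := by
  have hf' : ContDiff ℝ 1 (fderiv ℝ f) := hf.fderiv_right (by norm_num)
  have hg' : ContDiff ℝ 1 (fderiv ℝ g) := hg.fderiv_right (by norm_num)
  have h1 : fderiv ℝ (f + g) = fderiv ℝ f + fderiv ℝ g := funext fun y =>
    fderiv_add (hf.differentiable (by norm_num) y) (hg.differentiable (by norm_num) y)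
  have h2 : fderiv ℝ (fderiv ℝ (f + g)) x =
      fderiv ℝ (fderiv ℝ f) x + fderiv ℝ (fderiv ℝ g) x := by
    rw [h1, fderiv_add (hf'.differentiable (by norm_num) x) (hg'.differentiable (by norm_num) x)]
  rw [box_eq_fderiv (f := f + g) (hf.add hg), box_eq_fderiv hf, box_eq_fderiv hg, h2]
  simp only [add_apply, Finset.sum_add_distrib]
  ring

lemma integral_fourierInv (φ : 𝓢(Space, ℂ)) : ∫ k, (𝓕⁻ φ) k = φ 0 := by
  have h : (𝓕 (𝓕⁻ φ)) 0 = φ 0 := by rw [FourierTransform.fourier_fourierInv_eq]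
  rw [← h, SchwartzMap.fourier_coe, Real.fourier_eq']
  simp

lemma pauliJordan_zero (m : ℝ) (φ : 𝓢(Space, ℂ)) : pauliJordan m 0 φ = 0 := by
  simp [pauliJordan_apply, pauliJordanSymbol]

lemma pauliJordanDot_zero (m : ℝ) (φ : 𝓢(Space, ℂ)) : pauliJordanDot m 0 φ = φ 0 := by
  simp [pauliJordanDot_apply, integral_fourierInv]

lemma pauliJordanDot_neg (m t : ℝ) (φ : 𝓢(Space, ℂ)) :
    pauliJordanDot m (-t) φ = pauliJordanDot m t φ := by
  simp [pauliJordanDot_apply]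

/-- The superposition of plane waves with Cauchy data given by the inverse Fourier transforms of
`g` and `h`. -/
def planeWaveSolution (m : ℝ) (g h : 𝓢(Space, ℂ)) : Minkowski → ℂ :=
  superposition (volume.map (massShell m 1)) (fun v => amplitude m 1 g h v.2) +
    superposition (volume.map (massShell m (-1))) (fun v => amplitude m (-1) g h v.2)

section PlaneWaveSolution

variable (m : ℝ) (g h : 𝓢(Space, ℂ))

lemma integrable_norm_pow_mul_amplitude {σ : ℝ} (hσ : |σ| = 1) (n : ℕ) :
    Integrable (fun v => ‖v‖ ^ n * ‖amplitude m σ g h v.2‖) (volume.map (massShell m σ)) :=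
  integrable_norm_pow_mul_massShell m σ hσ
    (measurable_amplitude m σ g.continuous.measurable h.continuous.measurable)
    (amplitude_decay m σ hσ g h) n

lemma contDiff_planeWaveSolution : ContDiff ℝ ∞ (planeWaveSolution m g h) :=
  (contDiff_superposition (integrable_norm_pow_mul_amplitude m g h abs_one)).add
    (contDiff_superposition (integrable_norm_pow_mul_amplitude m g h (by simp)))

lemma kleinGordon_planeWaveSolution (x : Minkowski) :
    -box (planeWaveSolution m g h) x + (m : ℂ) ^ 2 * planeWaveSolution m g h x = 0 := by
  have hm (σ : ℝ) : AEStronglyMeasurable (fun v : ℝ × Space => amplitude m σ g h v.2)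
      (volume.map (massShell m σ)) :=
    ((measurable_amplitude m σ g.continuous.measurable h.continuous.measurable).comp
      measurable_snd).aestronglyMeasurable
  have h1 := integrable_norm_pow_mul_amplitude m g h abs_one
  have h2 := integrable_norm_pow_mul_amplitude m g h (σ := -1) (by simp)
  rw [planeWaveSolution, box_add (contDiff_infty.1 (contDiff_superposition h1) 2)
    (contDiff_infty.1 (contDiff_superposition h2) 2), Pi.add_apply]
  linear_combination kleinGordon_superposition h1 (hm 1) (massShell_eq m 1 abs_one) x +
    kleinGordon_superposition h2 (hm (-1)) (massShell_eq m (-1) (by simp)) x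

lemma superposition_massShell_apply (σ t : ℝ) (x : Space) {a : Space → ℂ} (ha : Measurable a) :
    superposition (volume.map (massShell m σ)) (fun v => a v.2) (t, x) =
      ∫ k, Complex.exp (2 * Real.pi * inner ℝ k x * Complex.I) *
        (Complex.exp (σ * (t * energy m ((2 * Real.pi) • k) : ℝ) * Complex.I) * a k) := by
  rw [superposition_apply, integral_map (continuous_massShell m σ).aemeasurable
    (Measurable.aestronglyMeasurable (by fun_prop))]
  refine integral_congr_ae (Filter.Eventually.of_forall fun k => ?_)
  simp only [massShell]
  rw [← mul_assoc, ← Complex.exp_add]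
  congr 2
  have : (Real.pi : ℂ) ≠ 0 := by exact_mod_cast Real.pi_ne_zero
  push_cast
  field_simp
  ring

lemma norm_exp_two_pi_mul_I (r : ℝ) : ‖Complex.exp (2 * Real.pi * r * Complex.I)‖ = 1 := by
  have : (2 * Real.pi * r * Complex.I : ℂ) = ((2 * Real.pi * r : ℝ) : ℂ) * Complex.I := by
    push_cast; ring
  rw [this, Complex.norm_exp_ofReal_mul_I]

lemma integrable_amplitude {σ : ℝ} (hσ : |σ| = 1) : Integrable (amplitude m σ g h) := by
  have hm := measurable_amplitude m σ g.continuous.measurable h.continuous.measurable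
  have h0 := integrable_norm_pow_mul_amplitude m g h hσ 0
  rw [integrable_map_measure (Measurable.aestronglyMeasurable (by fun_prop))
    (continuous_massShell m σ).aemeasurable] at h0
  exact (integrable_norm_iff hm.aestronglyMeasurable).1 (h0.congr
    (Filter.Eventually.of_forall fun k => by simp [massShell]))

/-- The amplitudes are those for which Euler's formulas combine the factors exp(±itE) into cos(tE) g
+ (sin(tE)/E) h. -/
lemma planeWaveSolution_apply (t : ℝ) (x : Space) :
    planeWaveSolution m g h (t, x) =
      (∫ k, (Real.cos (t * energy m ((2 * Real.pi) • k)) : ℂ) *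
        (Complex.exp (2 * Real.pi * inner ℝ k x * Complex.I) * g k)) +
      ∫ k, pauliJordanSymbol m t k *
        (Complex.exp (2 * Real.pi * inner ℝ k x * Complex.I) * h k) := by
  have hE := continuous_energy m
  have hm (σ : ℝ) :=
    measurable_amplitude m σ g.continuous.measurable h.continuous.measurable
  have he (f : Space → ℂ) (hf : Integrable f) :
      Integrable fun k => Complex.exp (2 * Real.pi * inner ℝ k x * Complex.I) * f k :=
    hf.bdd_mul (c := 1) (Continuous.aestronglyMeasurable (by fun_prop))
      (Filter.Eventually.of_forall fun k => (norm_exp_two_pi_mul_I _).le)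
  have hw (σ : ℝ) (hσ : |σ| = 1) := he _ ((integrable_amplitude m g h hσ).bdd_mul (c := 1)
    (f := fun k => Complex.exp (σ * (t * energy m ((2 * Real.pi) • k) : ℝ) * Complex.I))
    (Continuous.aestronglyMeasurable (by fun_prop))
    (Filter.Eventually.of_forall fun k => by
      rw [← Complex.ofReal_mul, Complex.norm_exp_ofReal_mul_I]))
  rw [planeWaveSolution, Pi.add_apply, superposition_massShell_apply m 1 t x (hm 1),
    superposition_massShell_apply m (-1) t x (hm (-1)),
    ← integral_add (hw 1 abs_one) (hw (-1) (by simp)), ← integral_add]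
  · refine integral_congr_ae ?_
    filter_upwards [Measure.ae_ne volume (0 : Space)] with k hk
    have hE : energy m ((2 * Real.pi) • k) ≠ 0 :=
      energy_ne_zero m (smul_ne_zero (by positivity) hk)
    simp only [amplitude, pauliJordanSymbol, Complex.ofReal_div, Complex.ofReal_cos,
      Complex.ofReal_sin, Complex.ofReal_one, Complex.ofReal_neg, one_mul, neg_mul]
    rw [Complex.cos, Complex.sin]
    have hE' : (energy m ((2 * Real.pi) • k) : ℂ) ≠ 0 := by exact_mod_cast hE
    have hI := Complex.I_ne_zero
    simp only [neg_mul]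
    generalize Complex.exp (-(((t * energy m ((2 * Real.pi) • k) : ℝ) : ℂ) * Complex.I)) = A
    generalize Complex.exp (((t * energy m ((2 * Real.pi) • k) : ℝ) : ℂ) * Complex.I) = B
    field_simp
    linear_combination (B - A) * h k * Complex.I_sq
  · refine (he _ g.integrable).bdd_mul (c := 1) (Continuous.aestronglyMeasurable (by fun_prop))
      (Filter.Eventually.of_forall fun k => ?_)
    rw [Complex.norm_real]
    exact Real.abs_cos_le_one _
  · exact (he _ h.integrable).bdd_mul (c := |t|)
      (measurable_pauliJordanSymbol m t).aestronglyMeasurable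
      (Filter.Eventually.of_forall (norm_pauliJordanSymbol_le m t))

end PlaneWaveSolution

section CauchyData

variable {ς ϑ : Space → ℂ} (hς : ContDiff ℝ ∞ ς) (hςc : HasCompactSupport ς)
  (hϑ : ContDiff ℝ ∞ ϑ) (hϑc : HasCompactSupport ϑ)

lemma planeWaveSolution_eq_distConv (m t : ℝ) (x : Space) :
    planeWaveSolution m (𝓕 (hςc.toSchwartzMap hς)) (𝓕 (hϑc.toSchwartzMap hϑ)) (t, x) =
      distConv (pauliJordanDot m t) ς hς hςc x + distConv (pauliJordan m t) ϑ hϑ hϑc x := by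
  rw [planeWaveSolution_apply, distConv, distConv, pauliJordanDot_apply, pauliJordan_apply]
  simp only [fourierInv_reflectTranslate]
  rfl

/-- The D-term has derivative ϑ at time zero. The Ḋ-term is even in t, so its derivative there
vanishes as soon as it exists; it exists because this term is the smooth solution minus the D-term.
-/
lemma timeDeriv_planeWaveSolution_zero (m : ℝ) (x : Space) :
    timeDeriv (planeWaveSolution m (𝓕 (hςc.toSchwartzMap hς)) (𝓕 (hϑc.toSchwartzMap hϑ))) (0, x) =
      ϑ x := by
  set ζ := planeWaveSolution m (𝓕 (hςc.toSchwartzMap hς)) (𝓕 (hϑc.toSchwartzMap hϑ)) with hζ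
  have hform (t : ℝ) := planeWaveSolution_eq_distConv hς hςc hϑ hϑc m t x
  have hD := hasDerivAt_pauliJordan m 0 (reflectTranslate ϑ hϑ hϑc x)
  have hD0 : HasDerivAt (fun s => distConv (pauliJordan m s) ϑ hϑ hϑc x) (ϑ x) 0 := by
    simp only [zero_mul, Real.cos_zero, Complex.ofReal_one, one_mul, integral_fourierInv] at hD
    have hx : reflectTranslate ϑ hϑ hϑc x 0 = ϑ x := congrArg ϑ (sub_zero x)
    rw [← hx]
    exact hD
  have hsmooth : ContDiff ℝ ∞ ζ := contDiff_planeWaveSolution m _ _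
  have hζt : DifferentiableAt ℝ (fun s : ℝ => ζ (s, x)) 0 :=
    (hsmooth.comp (contDiff_id.prodMk contDiff_const)).differentiable (by simp) 0
  have hC : (fun s => distConv (pauliJordanDot m s) ς hς hςc x) =
      fun s => ζ (s, x) - distConv (pauliJordan m s) ϑ hϑ hϑc x := by
    ext s; rw [hζ, hform]; ring
  have hCdiff : DifferentiableAt ℝ (fun s => distConv (pauliJordanDot m s) ς hς hςc x) 0 := by
    rw [hC]; exact hζt.sub hD0.differentiableAt
  have hC0 : deriv (fun s => distConv (pauliJordanDot m s) ς hς hςc x) 0 = 0 := by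
    have h := deriv_comp_neg (fun s => distConv (pauliJordanDot m s) ς hς hςc x) 0
    simp only [distConv, pauliJordanDot_neg, neg_zero] at h
    exact self_eq_neg.1 h
  have hsum : (fun s : ℝ => ζ (s, x)) = fun s =>
      distConv (pauliJordanDot m s) ς hς hςc x + distConv (pauliJordan m s) ϑ hϑ hϑc x :=
    funext hform
  change deriv (fun s : ℝ => ζ (s, x)) 0 = ϑ x
  have h := (hCdiff.hasDerivAt.add hD0).deriv
  rw [hC0, zero_add] at h
  rw [hsum]
  exact h

lemma planeWaveSolution_zero (m : ℝ) (x : Space) :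
    planeWaveSolution m (𝓕 (hςc.toSchwartzMap hς)) (𝓕 (hϑc.toSchwartzMap hϑ)) (0, x) = ς x := by
  rw [planeWaveSolution_eq_distConv, distConv, distConv, pauliJordan_zero, pauliJordanDot_zero,
    add_zero]
  exact congrArg ς (sub_zero x)

end CauchyData

/-! ### Integrals over time slices of functions supported in a backward cone -/

section ConeSupport

variable {F : Minkowski → ℝ} {R : ℝ} {x₀ : Space}

/-- The strict inequality cuts out an open set, so F vanishes in a neighbourhood of x. -/
lemma fderiv_eq_zero_of_coneSupport
    (hF : ∀ x : Minkowski, R ≤ x.1 + ‖x.2 - x₀‖ → F x = 0) {x : Minkowski}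
    (hx : R < x.1 + ‖x.2 - x₀‖) : fderiv ℝ F x = 0 := by
  have ho : IsOpen {x : Minkowski | R < x.1 + ‖x.2 - x₀‖} :=
    isOpen_lt continuous_const (by fun_prop)
  have h : F =ᶠ[nhds x] fun _ => 0 :=
    Filter.eventually_of_mem (ho.mem_nhds hx) fun y hy => hF y (le_of_lt hy)
  rw [h.fderiv_eq, fderiv_fun_const]
  rfl

lemma integrable_slice {f : Minkowski → ℝ} (hf : Continuous f)
    (hsupp : ∀ x : Minkowski, R < x.1 + ‖x.2 - x₀‖ → f x = 0) (t : ℝ) :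
    Integrable (fun y : Space => f (t, y)) := by
  refine Continuous.integrable_of_hasCompactSupport (by fun_prop)
    (HasCompactSupport.intro (isCompact_closedBall x₀ (R - t)) fun y hy => hsupp _ ?_)
  rw [Metric.mem_closedBall, dist_eq_norm, not_le] at hy
  change R < t + ‖y - x₀‖
  linarith

lemma hasDerivAt_integral_slice (hF1 : ContDiff ℝ 1 F)
    (hF : ∀ x : Minkowski, R ≤ x.1 + ‖x.2 - x₀‖ → F x = 0) (t : ℝ) :
    HasDerivAt (fun s => ∫ y : Space, F (s, y)) (∫ y : Space, fderiv ℝ F (t, y) (1, 0)) t := by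
  have hd : Continuous fun x => fderiv ℝ F x (1, 0) :=
    (hF1.continuous_fderiv (by norm_num)).clm_apply continuous_const
  -- For |s - t| < 1 every point of the slice farther than R - t + 1 from x₀ lies outside the cone,
  -- so one ball serves all these slices.
  have hK : IsCompact (Metric.closedBall t 1 ×ˢ Metric.closedBall x₀ (R - t + 1)) :=
    (isCompact_closedBall _ _).prod (isCompact_closedBall _ _)
  obtain ⟨C, hC⟩ := hK.exists_bound_of_continuousOn hd.continuousOn
  refine (hasDerivAt_integral_of_dominated_loc_of_deriv_le (s := Metric.ball t 1)
    (bound := (Metric.closedBall x₀ (R - t + 1)).indicator fun _ => C)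
    (F := fun s y => F (s, y)) (F' := fun s y => fderiv ℝ F (s, y) (1, 0))
    (Metric.ball_mem_nhds t one_pos) ?_ ?_ ?_ ?_ ?_ ?_).2
  · have := hF1.continuous
    exact Filter.Eventually.of_forall fun s => Continuous.aestronglyMeasurable (by fun_prop)
  · exact integrable_slice hF1.continuous (fun x hx => hF x hx.le) t
  · exact Continuous.aestronglyMeasurable (by fun_prop)
  · refine Filter.Eventually.of_forall fun y s hs => ?_
    by_cases hy : y ∈ Metric.closedBall x₀ (R - t + 1)
    · rw [Set.indicator_of_mem hy]
      exact hC (s, y) ⟨Metric.ball_subset_closedBall hs, hy⟩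
    · rw [Set.indicator_of_notMem hy, fderiv_eq_zero_of_coneSupport hF]
      · simp
      · rw [Metric.mem_closedBall, dist_eq_norm, not_le] at hy
        rw [Metric.mem_ball, Real.dist_eq, abs_lt] at hs
        change R < s + ‖y - x₀‖
        linarith
  · exact (integrable_indicator_iff measurableSet_closedBall).2
      (integrableOn_const (measure_closedBall_lt_top).ne)
  · refine Filter.Eventually.of_forall fun y s _ => ?_
    have h : HasDerivAt (fun s : ℝ => ((s, y) : Minkowski)) (1, 0) s :=
      (hasDerivAt_id s).prodMk (hasDerivAt_const s y)
    exact ((hF1.differentiable (by norm_num)) (s, y)).hasFDerivAt.comp_hasDerivAt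
      (f := fun s : ℝ => ((s, y) : Minkowski)) s h

/-- Integration by parts against the constant 1; the slice has compact support. -/
lemma integral_fderiv_slice_eq_zero (hF1 : ContDiff ℝ 1 F)
    (hF : ∀ x : Minkowski, R ≤ x.1 + ‖x.2 - x₀‖ → F x = 0) (t : ℝ) (v : Space) :
    ∫ y : Space, fderiv ℝ F (t, y) (0, v) = 0 := by
  have hd : Continuous fun x => fderiv ℝ F x (0, v) :=
    (hF1.continuous_fderiv (by norm_num)).clm_apply continuous_const
  have hfd (y : Space) : HasFDerivAt (fun y : Space => F (t, y))
      ((fderiv ℝ F (t, y)).comp (ContinuousLinearMap.inr ℝ ℝ Space)) y :=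
    ((hF1.differentiable (by norm_num)) (t, y)).hasFDerivAt.comp y (hasFDerivAt_prodMk_right t y)
  have heq (y : Space) : fderiv ℝ (fun y : Space => F (t, y)) y v = fderiv ℝ F (t, y) (0, v) := by
    rw [(hfd y).fderiv]; rfl
  have h := integral_mul_fderiv_eq_neg_fderiv_mul_of_integrable (μ := (volume : Measure Space))
    (f := fun _ : Space => (1 : ℝ)) (g := fun y => F (t, y)) (v := v) (by simp) ?_ ?_
    (fun _ _ => by fun_prop) (fun y _ => (hfd y).differentiableAt)
  · simpa [heq] using h
  · simp only [heq, one_mul]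
    exact integrable_slice hd (fun x hx => by rw [fderiv_eq_zero_of_coneSupport hF hx]; rfl) t
  · simp only [one_mul]
    exact integrable_slice hF1.continuous (fun x hx => hF x hx.le) t

end ConeSupport

/-! ### The cut-off function -/

/-- A smooth function which is positive exactly inside a hyperboloid approximating the backward
cone with vertex `(R, x₀)`. -/
def coneDepth (ε R : ℝ) (x₀ : Space) (x : Minkowski) : ℝ :=
  R - x.1 - √(ε ^ 2 + ‖x.2 - x₀‖ ^ 2)

section ConeDepth

variable {ε : ℝ} (R : ℝ) (x₀ : Space)

lemma contDiff_coneDepth (hε : 0 < ε) : ContDiff ℝ ∞ (coneDepth ε R x₀) := by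
  unfold coneDepth
  refine (contDiff_const.sub contDiff_fst).sub (ContDiff.sqrt ?_ fun x => by positivity)
  exact contDiff_const.add ((contDiff_snd.sub contDiff_const).norm_sq ℝ)

lemma fderiv_coneDepth (hε : 0 < ε) (x : Minkowski) (s : ℝ) (v : Space) :
    fderiv ℝ (coneDepth ε R x₀) x (s, v) =
      -s - inner ℝ (x.2 - x₀) v / √(ε ^ 2 + ‖x.2 - x₀‖ ^ 2) := by
  have h1 : HasFDerivAt (fun x : Minkowski => x.2 - x₀) (ContinuousLinearMap.snd ℝ ℝ Space) x :=
    hasFDerivAt_snd.sub_const x₀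
  have h2 := (h1.norm_sq.const_add (ε ^ 2)).sqrt (by positivity)
  have h3 := ((hasFDerivAt_fst (𝕜 := ℝ) (p := x)).const_sub R).sub h2
  have h4 : fderiv ℝ (coneDepth ε R x₀) x = _ := h3.fderiv
  rw [h4]
  simp [innerSL_apply_apply, inner_sub_left]
  ring

lemma coneDepth_nonpos {x : Minkowski} (hx : R ≤ x.1 + ‖x.2 - x₀‖) : coneDepth ε R x₀ x ≤ 0 := by
  have : ‖x.2 - x₀‖ ≤ √(ε ^ 2 + ‖x.2 - x₀‖ ^ 2) :=
    Real.le_sqrt_of_sq_le (by nlinarith [sq_nonneg ε])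
  unfold coneDepth
  linarith

end ConeDepth

/-! ### The energy estimate -/

/-- The vector y/√(ε² + |y|²) has length at most one, i.e. the hyperboloids are spacelike;
Cauchy–Schwarz and 2ab ≤ a² + b² do the rest. -/
lemma sum_gradient_le (p : ℝ) (q : Fin 3 → ℝ) {ε : ℝ} (hε : 0 < ε) (y : Space) :
    2 * (p * ∑ i, inner ℝ y (EuclideanSpace.basisFun (Fin 3) ℝ i) / √(ε ^ 2 + ‖y‖ ^ 2) * q i) ≤
      p ^ 2 + ∑ i, q i ^ 2 := by
  set r : Fin 3 → ℝ := fun i =>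
    inner ℝ y (EuclideanSpace.basisFun (Fin 3) ℝ i) / √(ε ^ 2 + ‖y‖ ^ 2)
  have hr : ∑ i, r i ^ 2 ≤ 1 := by
    simp only [r, div_pow, ← Finset.sum_div]
    rw [OrthonormalBasis.sum_sq_inner_left, Real.sq_sqrt (by positivity)]
    exact div_le_one_of_le₀ (by nlinarith) (by positivity)
  have hcs := Finset.sum_mul_sq_le_sq_mul_sq Finset.univ r q
  have hq : 0 ≤ ∑ i, q i ^ 2 := Finset.sum_nonneg fun i _ => sq_nonneg _
  have h1 : (∑ i, r i * q i) ^ 2 ≤ ∑ i, q i ^ 2 := hcs.trans (mul_le_of_le_one_left hq hr)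
  change 2 * (p * ∑ i, r i * q i) ≤ _
  nlinarith [sq_nonneg (p - ∑ i, r i * q i)]

/-- The energy density of `u`, weighted by `ψ`. -/
def energyDensity (m : ℝ) (ψ u : Minkowski → ℝ) (x : Minkowski) : ℝ :=
  ψ x * (fderiv ℝ u x (1, 0) ^ 2 +
    ∑ i, fderiv ℝ u x (0, EuclideanSpace.basisFun (Fin 3) ℝ i) ^ 2 + m ^ 2 * u x ^ 2)

/-- The component of the energy flux of `u` in the direction `v`, weighted by `ψ`. -/
def energyFlux (ψ u : Minkowski → ℝ) (v : Space) (x : Minkowski) : ℝ :=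
  ψ x * (fderiv ℝ u x (1, 0) * fderiv ℝ u x (0, v))

section Energy

variable {m : ℝ} {ψ u : Minkowski → ℝ}

lemma contDiff_energyDensity (hψ : ContDiff ℝ 1 ψ) (hu : ContDiff ℝ 2 u) :
    ContDiff ℝ 1 (energyDensity m ψ u) := by
  have hd : ContDiff ℝ 1 (fderiv ℝ u) := hu.fderiv_right (by norm_num)
  have hu1 : ContDiff ℝ 1 u := hu.of_le (by norm_num)
  unfold energyDensity
  fun_prop

lemma contDiff_energyFlux (hψ : ContDiff ℝ 1 ψ) (hu : ContDiff ℝ 2 u) (v : Space) :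
    ContDiff ℝ 1 (energyFlux ψ u v) := by
  have hd : ContDiff ℝ 1 (fderiv ℝ u) := hu.fderiv_right (by norm_num)
  unfold energyFlux
  fun_prop

lemma hasFDerivAt_fderiv_apply (hu : ContDiff ℝ 2 u) (x v : Minkowski) :
    HasFDerivAt (fun y => fderiv ℝ u y v)
      ((ContinuousLinearMap.apply ℝ ℝ v).comp (fderiv ℝ (fderiv ℝ u) x)) x := by
  have hd : ContDiff ℝ 1 (fderiv ℝ u) := hu.fderiv_right (by norm_num)
  exact (ContinuousLinearMap.apply ℝ ℝ v).hasFDerivAt.comp x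
    (hd.differentiable (by norm_num) x).hasFDerivAt

lemma fderiv_energyDensity (hψ : ContDiff ℝ 1 ψ) (hu : ContDiff ℝ 2 u) (x w : Minkowski) :
    fderiv ℝ (energyDensity m ψ u) x w =
      fderiv ℝ ψ x w * (fderiv ℝ u x (1, 0) ^ 2 +
        ∑ i, fderiv ℝ u x (0, EuclideanSpace.basisFun (Fin 3) ℝ i) ^ 2 + m ^ 2 * u x ^ 2) +
      2 * ψ x * (fderiv ℝ u x (1, 0) * fderiv ℝ (fderiv ℝ u) x w (1, 0) +
        ∑ i, fderiv ℝ u x (0, EuclideanSpace.basisFun (Fin 3) ℝ i) *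
          fderiv ℝ (fderiv ℝ u) x w (0, EuclideanSpace.basisFun (Fin 3) ℝ i) +
        m ^ 2 * (u x * fderiv ℝ u x w)) := by
  have h0 := (hu.differentiable (by norm_num) x).hasFDerivAt
  have hψ' := (hψ.differentiable (by norm_num) x).hasFDerivAt
  have hv (v : Minkowski) := (hasFDerivAt_fderiv_apply hu x v).pow 2
  have h := hψ'.mul (((hv (1, 0)).add (HasFDerivAt.fun_sum (u := Finset.univ) fun i _ =>
    hv (0, EuclideanSpace.basisFun (Fin 3) ℝ i))).add ((h0.pow 2).const_mul (m ^ 2)))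
  have h' : fderiv ℝ (energyDensity m ψ u) x = _ := h.fderiv
  rw [h']
  simp [Fin.sum_univ_three]
  ring

lemma fderiv_energyFlux (hψ : ContDiff ℝ 1 ψ) (hu : ContDiff ℝ 2 u) (v : Space)
    (x w : Minkowski) :
    fderiv ℝ (energyFlux ψ u v) x w =
      fderiv ℝ ψ x w * (fderiv ℝ u x (1, 0) * fderiv ℝ u x (0, v)) +
      ψ x * (fderiv ℝ (fderiv ℝ u) x w (1, 0) * fderiv ℝ u x (0, v) +
        fderiv ℝ u x (1, 0) * fderiv ℝ (fderiv ℝ u) x w (0, v)) := by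
  have hψ' := (hψ.differentiable (by norm_num) x).hasFDerivAt
  have h := hψ'.mul ((hasFDerivAt_fderiv_apply hu x (1, 0)).mul
    (hasFDerivAt_fderiv_apply hu x (0, v)))
  have h' : fderiv ℝ (energyFlux ψ u v) x = _ := h.fderiv
  rw [h']
  simp
  ring

/-- The real Klein–Gordon equation, in terms of second Fréchet derivatives. -/
def IsRealSolution (m : ℝ) (u : Minkowski → ℝ) : Prop :=
  ∀ x, fderiv ℝ (fderiv ℝ u) x (1, 0) (1, 0) =
    ∑ i, fderiv ℝ (fderiv ℝ u) x (0, EuclideanSpace.basisFun (Fin 3) ℝ i)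
      (0, EuclideanSpace.basisFun (Fin 3) ℝ i) - m ^ 2 * u x

/-- The cut-off inside a backward cone. -/
def coneWeight (ε R : ℝ) (x₀ : Space) (x : Minkowski) : ℝ :=
  expNegInvGlue (coneDepth ε R x₀ x)

lemma contDiff_coneWeight {ε : ℝ} (hε : 0 < ε) (R : ℝ) (x₀ : Space) :
    ContDiff ℝ 1 (coneWeight ε R x₀) :=
  (expNegInvGlue.contDiff (n := 1)).comp (contDiff_infty.1 (contDiff_coneDepth R x₀ hε) 1)

lemma coneWeight_eq_zero {ε R : ℝ} {x₀ : Space} {x : Minkowski}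
    (hx : R ≤ x.1 + ‖x.2 - x₀‖) : coneWeight ε R x₀ x = 0 :=
  expNegInvGlue.zero_of_nonpos (coneDepth_nonpos R x₀ hx)

lemma fderiv_coneWeight {ε : ℝ} (hε : 0 < ε) (R : ℝ) (x₀ : Space) (x : Minkowski) (s : ℝ)
    (v : Space) :
    fderiv ℝ (coneWeight ε R x₀) x (s, v) = deriv expNegInvGlue (coneDepth ε R x₀ x) *
      (-s - inner ℝ (x.2 - x₀) v / √(ε ^ 2 + ‖x.2 - x₀‖ ^ 2)) := by
  have h1 := ((contDiff_coneDepth R x₀ hε).differentiable (by simp) x).hasFDerivAt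
  have h2 := ((expNegInvGlue.contDiff (n := 1)).differentiable (by norm_num)
    (coneDepth ε R x₀ x)).hasDerivAt
  have h3 : fderiv ℝ (coneWeight ε R x₀) x = _ := (h2.comp_hasFDerivAt x h1).fderiv
  rw [h3, ← fderiv_coneDepth R x₀ hε]
  rfl

/-- Write e for the unweighted density, χ for the glue function and r for (x⃗ - x₀)/√(ε² + |x⃗ -
x₀|²). By the equation, ∂ₜe = 2 div(∂ₜu ∇u), so only derivatives of the weight survive in the
difference of the two sides: it equals -χ'(e - 2 ∂ₜu r·∇u), and this is nonpositive because χ is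
monotone and by `sum_gradient_le`. -/
lemma fderiv_energyDensity_le (hu : ContDiff ℝ 2 u) (hsol : IsRealSolution m u) {ε : ℝ}
    (hε : 0 < ε) (R : ℝ) (x₀ : Space) (x : Minkowski) :
    fderiv ℝ (energyDensity m (coneWeight ε R x₀) u) x (1, 0) ≤
      2 * ∑ i, fderiv ℝ (energyFlux (coneWeight ε R x₀) u (EuclideanSpace.basisFun (Fin 3) ℝ i)) x
        (0, EuclideanSpace.basisFun (Fin 3) ℝ i) := by
  have hψ := contDiff_coneWeight hε R x₀
  have hsymm (v w : Minkowski) :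
      fderiv ℝ (fderiv ℝ u) x v w = fderiv ℝ (fderiv ℝ u) x w v :=
    (hu.contDiffAt.isSymmSndFDerivAt (by simp)) v w
  have hmono : 0 ≤ deriv expNegInvGlue (coneDepth ε R x₀ x) := expNegInvGlue.monotone.deriv_nonneg
  have hgrad := sum_gradient_le (fderiv ℝ u x (1, 0))
    (fun i => fderiv ℝ u x (0, EuclideanSpace.basisFun (Fin 3) ℝ i)) hε (x.2 - x₀)
  have hu0 : 0 ≤ m ^ 2 * u x ^ 2 := by positivity
  have hkey := mul_nonneg hmono (sub_nonneg.2 (hgrad.trans (le_add_of_nonneg_right hu0)))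
  rw [fderiv_energyDensity hψ hu, hsol x]
  simp only [fderiv_energyFlux hψ hu, fderiv_coneWeight hε, hsymm (1, 0), inner_zero_right,
    Fin.sum_univ_three] at hkey ⊢
  linear_combination hkey

/-- The weighted energy is nonnegative, nonincreasing and zero initially, so its density vanishes at
all later times. The weight is positive on the axis up to time t, hence ∂ₜu = 0 there and u keeps
its initial value 0. -/
lemma eq_zero_of_cauchyData_eq_zero_on_ball (hu : ContDiff ℝ 2 u) (hsol : IsRealSolution m u)
    {R : ℝ} {x₀ : Space} (h0 : ∀ y ∈ Metric.ball x₀ R, u (0, y) = 0)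
    (h1 : ∀ y ∈ Metric.ball x₀ R, fderiv ℝ u (0, y) (1, 0) = 0) {t : ℝ} (ht : 0 ≤ t)
    (htR : t < R) : u (t, x₀) = 0 := by
  -- On the axis the depth at time s is R - s - ε, which stays positive up to s = t.
  obtain ⟨ε, hε, hεt⟩ : ∃ ε, 0 < ε ∧ t + ε < R := ⟨(R - t) / 2, by linarith, by linarith⟩
  set ψ := coneWeight ε R x₀ with hψdef
  have hψ : ContDiff ℝ 1 ψ := contDiff_coneWeight hε R x₀
  have hψ0 (x : Minkowski) (hx : R ≤ x.1 + ‖x.2 - x₀‖) : ψ x = 0 := coneWeight_eq_zero hx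
  set F := energyDensity m ψ u with hFdef
  have hF1 : ContDiff ℝ 1 F := contDiff_energyDensity hψ hu
  have hF0 (x : Minkowski) (hx : R ≤ x.1 + ‖x.2 - x₀‖) : F x = 0 := by
    simp [hFdef, energyDensity, hψ0 x hx]
  have hFnonneg (x : Minkowski) : 0 ≤ F x := by
    have := expNegInvGlue.nonneg (coneDepth ε R x₀ x)
    change 0 ≤ expNegInvGlue (coneDepth ε R x₀ x) * _
    positivity
  have hG0 (v : Space) (x : Minkowski) (hx : R ≤ x.1 + ‖x.2 - x₀‖) : energyFlux ψ u v x = 0 := by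
    simp [energyFlux, hψ0 x hx]
  have hderiv (s : ℝ) := hasDerivAt_integral_slice hF1 hF0 s
  have hint {f : Minkowski → ℝ} (hf : ContDiff ℝ 1 f)
      (hf0 : ∀ x : Minkowski, R ≤ x.1 + ‖x.2 - x₀‖ → f x = 0) (v : Minkowski) (s : ℝ) :
      Integrable fun y : Space => fderiv ℝ f (s, y) v :=
    integrable_slice (f := fun x => fderiv ℝ f x v)
      ((hf.continuous_fderiv (by norm_num)).clm_apply continuous_const)
      (fun x hx => by rw [fderiv_eq_zero_of_coneSupport hf0 hx]; rfl) s
  have hanti : Antitone fun s => ∫ y : Space, F (s, y) := by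
    refine antitone_of_deriv_nonpos (fun s => (hderiv s).differentiableAt) fun s => ?_
    rw [(hderiv s).deriv]
    have hflux (i : Fin 3) := hint (contDiff_energyFlux hψ hu (EuclideanSpace.basisFun (Fin 3) ℝ i))
      (hG0 _) (0, EuclideanSpace.basisFun (Fin 3) ℝ i) s
    refine (integral_mono (hint hF1 hF0 _ s)
      ((integrable_finsetSum Finset.univ fun i _ => hflux i).const_mul 2)
      fun y => fderiv_energyDensity_le hu hsol hε R x₀ (s, y)).trans_eq ?_
    rw [integral_const_mul, integral_finsetSum _ fun i _ => hflux i]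
    simp [integral_fderiv_slice_eq_zero (contDiff_energyFlux hψ hu _) (hG0 _)]
  have hinit : ∫ y : Space, F (0, y) = 0 := by
    refine integral_eq_zero_of_ae (Filter.Eventually.of_forall fun y => ?_)
    by_cases hy : y ∈ Metric.ball x₀ R
    -- The data vanish on an open ball, so the spatial gradient vanishes there too.
    · have hgrad (v : Space) : fderiv ℝ u (0, y) (0, v) = 0 := by
        have hz : (fun y : Space => u (0, y)) =ᶠ[nhds y] fun _ => 0 :=
          Filter.eventually_of_mem (Metric.isOpen_ball.mem_nhds hy) h0
        have hfd : HasFDerivAt (fun y : Space => u (0, y))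
            ((fderiv ℝ u (0, y)).comp (ContinuousLinearMap.inr ℝ ℝ Space)) y :=
          ((hu.differentiable (by norm_num)) (0, y)).hasFDerivAt.comp y
            (hasFDerivAt_prodMk_right 0 y)
        have h := hfd.fderiv
        rw [hz.fderiv_eq, fderiv_fun_const] at h
        exact (DFunLike.congr_fun h v).symm
      simp [hFdef, energyDensity, h0 y hy, h1 y hy, hgrad]
    · rw [Metric.mem_ball, dist_eq_norm, not_lt] at hy
      exact hF0 (0, y) (by simpa using hy)
  have hzero (s : ℝ) (hs : 0 ≤ s) (y : Space) : F (s, y) = 0 := by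
    have hle : ∫ y : Space, F (s, y) ≤ 0 := (hanti hs).trans_eq hinit
    have hI : ∫ y : Space, F (s, y) = 0 := le_antisymm hle (integral_nonneg fun y => hFnonneg _)
    have hFc : Continuous fun y : Space => F (s, y) := by
      have := hF1.continuous
      fun_prop
    have hae := (integral_eq_zero_iff_of_nonneg (fun y => hFnonneg (s, y))
      (integrable_slice hF1.continuous (fun x hx => hF0 x hx.le) s)).1 hI
    exact congrFun ((hFc.ae_eq_iff_eq volume continuous_const).1 hae) y
  -- Only ∂ₜu is read off from the density: for m = 0 it does not control u itself.
  have hut (s : ℝ) (hs : 0 ≤ s) (hst : s ≤ t) : fderiv ℝ u (s, x₀) (1, 0) = 0 := by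
    have hdepth : 0 < coneDepth ε R x₀ (s, x₀) := by
      simp only [coneDepth, sub_self, norm_zero]
      rw [zero_pow two_ne_zero, add_zero, Real.sqrt_sq hε.le]
      linarith
    have hpos : 0 < ψ (s, x₀) := expNegInvGlue.pos_of_pos hdepth
    have h := (mul_eq_zero.1 (hzero s hs x₀)).resolve_left hpos.ne'
    have hq : 0 ≤ ∑ i, fderiv ℝ u (s, x₀) (0, EuclideanSpace.basisFun (Fin 3) ℝ i) ^ 2 :=
      Finset.sum_nonneg fun i _ => sq_nonneg _
    have hm : 0 ≤ m ^ 2 * u (s, x₀) ^ 2 := by positivity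
    exact pow_eq_zero_iff two_ne_zero |>.1
      (le_antisymm (by linarith) (sq_nonneg (fderiv ℝ u (s, x₀) (1, 0))))
  have hline (s : ℝ) : HasDerivAt (fun s : ℝ => u (s, x₀)) (fderiv ℝ u (s, x₀) (1, 0)) s := by
    have h : HasDerivAt (fun s : ℝ => ((s, x₀) : Minkowski)) (1, 0) s :=
      (hasDerivAt_id s).prodMk (hasDerivAt_const s x₀)
    exact ((hu.differentiable (by norm_num)) (s, x₀)).hasFDerivAt.comp_hasDerivAt
      (f := fun s : ℝ => ((s, x₀) : Minkowski)) s h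
  have hconst := constant_of_has_deriv_right_zero (a := 0) (b := t)
    (f := fun s : ℝ => u (s, x₀)) (fun s _ => (hline s).continuousAt.continuousWithinAt)
    (fun s hs => by
      have h := (hline s).hasDerivWithinAt (s := Set.Ici s)
      rwa [hut s hs.1 hs.2.le] at h) t ⟨ht, le_rfl⟩
  exact hconst.trans (h0 x₀ (Metric.mem_ball_self (ht.trans_lt htR)))

end Energy

/-! ### Finite speed of propagation -/

lemma fderiv_fderiv_comp_clm {E F G : Type*} [NormedAddCommGroup E] [NormedSpace ℝ E]
    [NormedAddCommGroup F] [NormedSpace ℝ F] [NormedAddCommGroup G] [NormedSpace ℝ G]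
    {u : F → G} (hu : ContDiff ℝ 2 u) (L : E →L[ℝ] F) (x a b : E) :
    fderiv ℝ (fderiv ℝ (u ∘ L)) x a b = fderiv ℝ (fderiv ℝ u) (L x) (L a) (L b) := by
  have hd : ContDiff ℝ 1 (fderiv ℝ u) := hu.fderiv_right (by norm_num)
  have h1 : fderiv ℝ (u ∘ L) = fun y => (fderiv ℝ u (L y)).comp L := funext fun y =>
    (((hu.differentiable (by norm_num)) (L y)).hasFDerivAt.comp y L.hasFDerivAt).fderiv
  have h2 : HasFDerivAt (fun y => fderiv ℝ u (L y)) ((fderiv ℝ (fderiv ℝ u) (L x)).comp L) x :=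
    ((hd.differentiable (by norm_num)) (L x)).hasFDerivAt.comp x L.hasFDerivAt
  rw [h1, (h2.clm_comp (hasFDerivAt_const L x)).fderiv]
  simp

lemma fderiv_clm_comp {f : Minkowski → ℂ} (hf : Differentiable ℝ f) (l : ℂ →L[ℝ] ℝ)
    (x : Minkowski) : fderiv ℝ (fun y => l (f y)) x = l.comp (fderiv ℝ f x) :=
  (l.hasFDerivAt.comp x (hf x).hasFDerivAt).fderiv

lemma fderiv_fderiv_clm_comp {f : Minkowski → ℂ} (hf : ContDiff ℝ 2 f) (l : ℂ →L[ℝ] ℝ)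
    (x a b : Minkowski) :
    fderiv ℝ (fderiv ℝ fun y => l (f y)) x a b = l (fderiv ℝ (fderiv ℝ f) x a b) := by
  have hd : ContDiff ℝ 1 (fderiv ℝ f) := hf.fderiv_right (by norm_num)
  rw [funext (fderiv_clm_comp (hf.differentiable (by norm_num)) l),
    ((hasFDerivAt_const l x).clm_comp (hd.differentiable (by norm_num) x).hasFDerivAt).fderiv]
  simp

/-- The operator has real coefficients, so it commutes with real-linear functionals such as Re and
Im. -/
lemma isRealSolution_clm_comp {m : ℝ} {f : Minkowski → ℂ} (hf : ContDiff ℝ 2 f)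
    (heq : ∀ x, -box f x + (m : ℂ) ^ 2 * f x = 0) (l : ℂ →L[ℝ] ℝ) :
    IsRealSolution m fun x => l (f x) := by
  intro x
  simp only [fderiv_fderiv_clm_comp hf]
  have h := heq x
  rw [box_eq_fderiv hf] at h
  have h' : fderiv ℝ (fderiv ℝ f) x (1, 0) (1, 0) =
      ∑ i, fderiv ℝ (fderiv ℝ f) x (0, EuclideanSpace.basisFun (Fin 3) ℝ i)
        (0, EuclideanSpace.basisFun (Fin 3) ℝ i) - (m ^ 2 : ℝ) • f x := by
    rw [Complex.real_smul]
    push_cast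
    linear_combination h
  rw [h', map_sub, map_sum, map_smul, smul_eq_mul]

/-- Time reversal on Minkowski space. -/
def timeReversal : Minkowski →L[ℝ] Minkowski :=
  (-ContinuousLinearMap.fst ℝ ℝ Space).prod (ContinuousLinearMap.snd ℝ ℝ Space)

lemma timeReversal_apply (t : ℝ) (x : Space) : timeReversal (t, x) = (-t, x) := rfl

/-- Time enters only through ∂ₜ², so the two signs cancel. -/
lemma IsRealSolution.comp_timeReversal {m : ℝ} {u : Minkowski → ℝ} (hu : ContDiff ℝ 2 u)
    (hsol : IsRealSolution m u) : IsRealSolution m (u ∘ timeReversal) := by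
  intro x
  simp only [fderiv_fderiv_comp_clm hu, timeReversal_apply, neg_zero, Function.comp_apply]
  have h : ((-1 : ℝ), (0 : Space)) = -((1 : ℝ), (0 : Space)) := by simp
  rw [h, map_neg, map_neg, neg_apply, neg_neg, hsol]

lemma eq_zero_of_cauchyData_eq_zero_on_ball_of_abs_lt {m : ℝ} {u : Minkowski → ℝ}
    (hu : ContDiff ℝ 2 u) (hsol : IsRealSolution m u)
    {R : ℝ} {x₀ : Space} (h0 : ∀ y ∈ Metric.ball x₀ R, u (0, y) = 0)
    (h1 : ∀ y ∈ Metric.ball x₀ R, fderiv ℝ u (0, y) (1, 0) = 0) {t : ℝ} (htR : |t| < R) :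
    u (t, x₀) = 0 := by
  rcases le_total 0 t with ht | ht
  · exact eq_zero_of_cauchyData_eq_zero_on_ball hu hsol h0 h1 ht (by rwa [abs_of_nonneg ht] at htR)
  · rw [abs_of_nonpos ht] at htR
    have h := eq_zero_of_cauchyData_eq_zero_on_ball (u := u ∘ timeReversal)
      (hu.comp timeReversal.contDiff) (hsol.comp_timeReversal hu) (R := R) (x₀ := x₀)
      (fun y hy => by simpa [timeReversal_apply] using h0 y hy) (fun y hy => ?_)
      (neg_nonneg.2 ht) htR
    · simpa [timeReversal_apply] using h
    · have hc : fderiv ℝ (u ∘ timeReversal) (0, y) = _ :=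
        (((hu.differentiable (by norm_num)) (timeReversal (0, y))).hasFDerivAt.comp (0, y)
          timeReversal.hasFDerivAt).fderiv
      have hv : ((-1 : ℝ), (0 : Space)) = -((1 : ℝ), (0 : Space)) := by simp
      rw [hc, ContinuousLinearMap.comp_apply, timeReversal_apply, timeReversal_apply, neg_zero, hv,
        map_neg, h1 y hy, neg_zero]

section Propagation

variable {m : ℝ} {ζ : Minkowski → ℂ}

/-- Keeping a single functional l lets the imaginary part be treated alone, which is what reality of
the solution needs. -/
lemma clm_apply_eq_zero_of_cauchyData (hζ : ContDiff ℝ ∞ ζ)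
    (heq : ∀ x, -box ζ x + (m : ℂ) ^ 2 * ζ x = 0) (l : ℂ →L[ℝ] ℝ) {R : ℝ} {x₀ : Space}
    (h0 : ∀ y ∈ Metric.ball x₀ R, l (ζ (0, y)) = 0)
    (h1 : ∀ y ∈ Metric.ball x₀ R, l (timeDeriv ζ (0, y)) = 0) {t : ℝ} (htR : |t| < R) :
    l (ζ (t, x₀)) = 0 := by
  have hζ2 : ContDiff ℝ 2 ζ := contDiff_infty.1 hζ 2
  have hd := hζ2.differentiable (by norm_num)
  refine eq_zero_of_cauchyData_eq_zero_on_ball_of_abs_lt (u := fun x => l (ζ x))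
    (l.contDiff.comp hζ2) (isRealSolution_clm_comp hζ2 heq l) h0 (fun y hy => ?_) htR
  rw [fderiv_clm_comp hd, ContinuousLinearMap.comp_apply, ← timeDeriv_eq_fderiv hd]
  exact h1 y hy

lemma eq_zero_of_cauchyData (hζ : ContDiff ℝ ∞ ζ)
    (heq : ∀ x, -box ζ x + (m : ℂ) ^ 2 * ζ x = 0) {R : ℝ} {x₀ : Space}
    (h0 : ∀ y ∈ Metric.ball x₀ R, ζ (0, y) = 0)
    (h1 : ∀ y ∈ Metric.ball x₀ R, timeDeriv ζ (0, y) = 0) {t : ℝ} (htR : |t| < R) :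
    ζ (t, x₀) = 0 := by
  have h (l : ℂ →L[ℝ] ℝ) : l (ζ (t, x₀)) = 0 :=
    clm_apply_eq_zero_of_cauchyData hζ heq l (fun y hy => by rw [h0 y hy, map_zero])
      (fun y hy => by rw [h1 y hy, map_zero]) htR
  exact Complex.ext (h Complex.reCLM) (h Complex.imCLM)

lemma mem_causalShadow_timeZero {K : Set Space} {t : ℝ} {x y : Space} (hy : y ∈ K)
    (h : ‖x - y‖ ≤ |t|) : (t, x) ∈ causalShadow (timeZero '' K) := by
  have hsq : minkowskiSq (t, x - y) ≤ 0 := by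
    have : ‖x - y‖ ^ 2 ≤ t ^ 2 := by
      rw [← sq_abs t]
      exact pow_le_pow_left₀ (norm_nonneg _) h 2
    simp only [minkowskiSq]
    linarith
  refine Set.mem_add.2 ⟨timeZero y, Set.mem_image_of_mem _ hy, (t, x - y), ?_, by simp [timeZero]⟩
  rcases le_total 0 t with ht | ht
  · exact Or.inl ⟨hsq, ht⟩
  · exact Or.inr ⟨hsq, ht⟩

/-- If |t| is less than the distance from x⃗ to K, the ball of that radius about x⃗ misses K and the
solution vanishes at (t, x⃗). The remaining set is closed, so it contains the support, and
compactness of K supplies a nearest point. -/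
lemma tsupport_subset_causalShadow (hζ : ContDiff ℝ ∞ ζ)
    (heq : ∀ x, -box ζ x + (m : ℂ) ^ 2 * ζ x = 0) {K : Set Space} (hK : IsCompact K)
    (h0 : ∀ y ∉ K, ζ (0, y) = 0) (h1 : ∀ y ∉ K, timeDeriv ζ (0, y) = 0) :
    tsupport ζ ⊆ causalShadow (timeZero '' K) := by
  -- `Metric.infDist` to the empty set is 0, so the distance criterion says nothing in that case.
  rcases K.eq_empty_or_nonempty with rfl | hne
  · have : ζ = 0 := funext fun x => eq_zero_of_cauchyData hζ heq (R := |x.1| + 1) (x₀ := x.2)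
      (fun y _ => h0 y (Set.notMem_empty y)) (fun y _ => h1 y (Set.notMem_empty y)) (lt_add_one _)
    simp [this]
  · have hcl : IsClosed {x : Minkowski | Metric.infDist x.2 K ≤ |x.1|} :=
      isClosed_le ((Metric.continuous_infDist_pt K).comp continuous_snd) (by fun_prop)
    have hsupp : tsupport ζ ⊆ {x : Minkowski | Metric.infDist x.2 K ≤ |x.1|} := by
      refine closure_minimal (fun x hx => ?_) hcl
      by_contra hlt
      have hball : ∀ y ∈ Metric.ball x.2 (Metric.infDist x.2 K), y ∉ K := fun y hy hyK =>
        (Metric.infDist_le_dist_of_mem hyK).not_gt (by rwa [Metric.mem_ball, dist_comm] at hy)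
      exact hx (eq_zero_of_cauchyData hζ heq (fun y hy => h0 y (hball y hy))
        (fun y hy => h1 y (hball y hy)) (not_le.1 hlt))
    intro x hx
    obtain ⟨y, hy, hxy⟩ := hK.exists_infDist_eq_dist hne x.2
    exact mem_causalShadow_timeZero hy (by rw [← dist_eq_norm, ← hxy]; exact hsupp hx)

end Propagation

/-! ### Uniqueness and reality -/

lemma box_sub {f g : Minkowski → ℂ} (hf : ContDiff ℝ 2 f) (hg : ContDiff ℝ 2 g) (x : Minkowski) :
    box (f - g) x = box f x - box g x := by
  have h := box_add (hf.sub hg) hg x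
  rw [show (fun y => f y - g y) + g = f from sub_add_cancel f g] at h
  exact eq_sub_of_add_eq h.symm

/-- The difference has zero data on all of space, so at time t any ball of radius exceeding |t| will
do; |t| + 1 is one choice. -/
lemma IsCauchySolution.unique {m : ℝ} {ς ϑ : Space → ℂ} {ζ ξ : Minkowski → ℂ}
    (hζ : IsCauchySolution m ς ϑ ζ) (hξ : IsCauchySolution m ς ϑ ξ) : ζ = ξ := by
  have hdζ : Differentiable ℝ ζ := hζ.smooth.differentiable (by simp)
  have hdξ : Differentiable ℝ ξ := hξ.smooth.differentiable (by simp)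
  funext x
  refine sub_eq_zero.1 (eq_zero_of_cauchyData (m := m) (ζ := ζ - ξ) (R := |x.1| + 1) (x₀ := x.2)
    (hζ.smooth.sub hξ.smooth) (fun y => ?_) (fun y _ => ?_) (fun y _ => ?_) (lt_add_one _))
  · rw [box_sub (contDiff_infty.1 hζ.smooth 2) (contDiff_infty.1 hξ.smooth 2), Pi.sub_apply]
    linear_combination hζ.equation y - hξ.equation y
  · rw [Pi.sub_apply, hζ.value_zero, hξ.value_zero, sub_self]
  · have h1 := hζ.timeDeriv_zero y
    have h2 := hξ.timeDeriv_zero y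
    rw [timeDeriv_eq_fderiv hdζ] at h1
    rw [timeDeriv_eq_fderiv hdξ] at h2
    rw [timeDeriv_eq_fderiv (hdζ.sub hdξ), fderiv_sub (hdζ _) (hdξ _), sub_apply, h1, h2, sub_self]

lemma IsCauchySolution.im_eq_zero {m : ℝ} {ς ϑ : Space → ℂ} {ζ : Minkowski → ℂ}
    (hζ : IsCauchySolution m ς ϑ ζ) (hς : ∀ x, (ς x).im = 0) (hϑ : ∀ x, (ϑ x).im = 0)
    (x : Minkowski) : (ζ x).im = 0 :=
  clm_apply_eq_zero_of_cauchyData hζ.smooth hζ.equation Complex.imCLM (R := |x.1| + 1)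
    (fun y _ => by rw [hζ.value_zero]; exact hς y)
    (fun y _ => by rw [hζ.timeDeriv_zero]; exact hϑ y) (lt_add_one _)

/-! ### Support of solutions and existence -/

section Solution

variable {ς ϑ : Space → ℂ}

lemma tsupport_subset_of_cauchyData {m : ℝ} {ζ : Minkowski → ℂ} (hςc : HasCompactSupport ς)
    (hϑc : HasCompactSupport ϑ) (hζ : ContDiff ℝ ∞ ζ)
    (heq : ∀ x, -box ζ x + (m : ℂ) ^ 2 * ζ x = 0) (h0 : ∀ y, ζ (0, y) = ς y)
    (h1 : ∀ y, timeDeriv ζ (0, y) = ϑ y) :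
    tsupport ζ ⊆ causalShadow (timeZero '' (tsupport ς ∪ tsupport ϑ)) :=
  tsupport_subset_causalShadow hζ heq (hςc.isCompact.union hϑc.isCompact)
    (fun y hy => (h0 y).trans (image_eq_zero_of_notMem_tsupport fun h => hy (Or.inl h)))
    (fun y hy => (h1 y).trans (image_eq_zero_of_notMem_tsupport fun h => hy (Or.inr h)))

lemma isCauchySolution_planeWaveSolution (m : ℝ) (hς : ContDiff ℝ ∞ ς)
    (hςc : HasCompactSupport ς) (hϑ : ContDiff ℝ ∞ ϑ) (hϑc : HasCompactSupport ϑ) :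
    IsCauchySolution m ς ϑ
      (planeWaveSolution m (𝓕 (hςc.toSchwartzMap hς)) (𝓕 (hϑc.toSchwartzMap hϑ))) where
  smooth := contDiff_planeWaveSolution m _ _
  spaceCompact := ⟨timeZero '' (tsupport ς ∪ tsupport ϑ),
    (hςc.isCompact.union hϑc.isCompact).image (by unfold timeZero; fun_prop),
    tsupport_subset_of_cauchyData hςc hϑc (contDiff_planeWaveSolution m _ _)
      (kleinGordon_planeWaveSolution m _ _) (planeWaveSolution_zero hς hςc hϑ hϑc m)
      (timeDeriv_planeWaveSolution_zero hς hςc hϑ hϑc m)⟩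
  equation := kleinGordon_planeWaveSolution m _ _
  value_zero := planeWaveSolution_zero hς hςc hϑ hϑc m
  timeDeriv_zero := timeDeriv_planeWaveSolution_zero hς hςc hϑ hϑc m

end Solution

end KleinGordon

end

theorem mainTheorem9 (m : ℝ) (ς ϑ : KleinGordon.Space → ℂ)
    (hς : ContDiff ℝ ∞ ς) (hςc : HasCompactSupport ς)
    (hϑ : ContDiff ℝ ∞ ϑ) (hϑc : HasCompactSupport ϑ) :
    (∀ (φ : 𝓢(KleinGordon.Space, ℂ)),
      Differentiable ℝ (fun s : ℝ => KleinGordon.pauliJordan m s φ)) ∧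
    (∃! ζ : KleinGordon.Minkowski → ℂ, KleinGordon.IsCauchySolution m ς ϑ ζ) ∧
    (∀ ζ : KleinGordon.Minkowski → ℂ, KleinGordon.IsCauchySolution m ς ϑ ζ →
      tsupport ζ ⊆
        KleinGordon.causalShadow (KleinGordon.timeZero '' (tsupport ς ∪ tsupport ϑ)) ∧
      (∀ (t : ℝ) (x : KleinGordon.Space),
        ζ (t, x) =
          KleinGordon.distConv (KleinGordon.pauliJordanDot m t) ς hς hςc x +
          KleinGordon.distConv (KleinGordon.pauliJordan m t) ϑ hϑ hϑc x) ∧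
      ((∀ x, (ς x).im = 0) → (∀ x, (ϑ x).im = 0) → ∀ x, (ζ x).im = 0)) := by
  have hsol := KleinGordon.isCauchySolution_planeWaveSolution m hς hςc hϑ hϑc
  refine ⟨KleinGordon.differentiable_pauliJordan m, ⟨_, hsol, fun ξ hξ => hξ.unique hsol⟩,
    fun ζ hζ => ⟨KleinGordon.tsupport_subset_of_cauchyData hςc hϑc hζ.smooth hζ.equation
      hζ.value_zero hζ.timeDeriv_zero, fun t x => ?_, fun h1 h2 => hζ.im_eq_zero h1 h2⟩⟩
  rw [hζ.unique hsol, KleinGordon.planeWaveSolution_eq_distConv]
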